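/- Let $n\ge 2$, let $\Omega,T\subset\mathbb R^n$ be bounded domains (nonempty, open, connected), let $\beta>0$, and let $I$ on $\Omega$ and $L$ on $T$ be non-negative integrable functions with $\int_T L\,dp=\int_\Omega I\,dx$. Put $$k_{p,c}(x)=\frac{\beta^2-|x-p|^2}{2\beta}+c,\qquad h_{x,c}(p)=\frac{|x-p|^2-\beta^2}{2\beta}+c .$$ A pair $(z,w)\in C(\overline\Omega)\times C(\overline T)$ is a two-reflector of type A if $$z(x)=\sup_{p\in\overline T}k_{p,w(p)}(x)\ \ (x\in\overline\Omega),\qquad w(p)=\inf_{x\in\overline\Omega}h_{x,z(x)}(p)\ \ (p\in\overline T),$$ and of type B if the same holds with $\sup$ and $\inf$ exchanged. Let $Q(x,p)=\langle x,p\rangle+\beta w(p)-\tfrac12|p|^2$ and, for $x\in\mathbb R^n$, let $V^*(x)=\sup_{p\in\overline T}Q(x,p)$ for type A and $V^*(x)=\inf_{p\in\overline T}Q(x,p)$ for type B. The (possibly multivalued) ray tracing map $\tilde P$ assigns to $x\in\mathbb R^n$ the set of all $p\in\mathbb R^n$ such that, for all $y\in\mathbb R^n$, $$V^*(y)\ge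 V^*(x)+\langle p,y-x\rangle\ \text{ (type A)},\qquad V^*(y)\le V^*(x)+\langle p,y-x\rangle\ \text{ (type B)}.$$ A two-reflector $(z,w)$ of type A (B) is a weak solution of type A (B) of the two-reflector problem if $\tilde P$ maps $\overline\Omega$ onto $\overline T$, i.e. every $p\in\overline T$ lies in $\tilde P(x)$ for some $x\in\overline\Omega$, and, for every Borel set $\tau\subseteq T$, $$\int_{\tilde P^{-1}(\tau)} I\,dx=\int_\tau L\,dp,$$ where $\tilde P^{-1}(\tau)=\{x\in\mathbb R^n:\tilde P(x)\cap\tau\ne\emptyset\}$ and $I$ is extended by $0$ outside $\Omega$. Suppose that $I>0$ everywhere in $\Omega$. If $(z,w)$ and $(z',w')$ are two weak solutions of the same type (both of type A, or both of type B), then there is a constant $\rho\in\mathbb R$ such that $$z'(x)=z(x)+\rho\ \text{ for all }x\in\overline\Omega,\qquad w'(p)=w(p)+\rho\ \text{ for all }p\in\overline T .$$ In other words, weak solutions of each type are unique up to a translation of the reflector system. -/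

import Mathlib

open MeasureTheory

noncomputable section

namespace TwoReflector

/-- The hyperplane `z = 0` in `ℝⁿ⁺¹`, identified with Euclidean `ℝⁿ`. -/
abbrev Plane (n : ℕ) : Type := EuclideanSpace ℝ (Fin n)

/-- A bounded domain: a nonempty, open, connected and bounded set. -/
structure IsBoundedDomain {n : ℕ} (G : Set (Plane n)) : Prop where
  isOpen : IsOpen G
  isConnected : IsConnected G
  isBounded : Bornology.IsBounded G

/-- The paraboloid `k_{p,c}(x) = (β² - |x - p|²) / (2β) + c`. -/
def paraboloidK {n : ℕ} (β : ℝ) (p : Plane n) (c : ℝ) (x : Plane n) : ℝ :=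
  (β ^ 2 - ‖x - p‖ ^ 2) / (2 * β) + c

/-- The paraboloid `h_{x,c}(p) = (|x - p|² - β²) / (2β) + c`. -/
def paraboloidH {n : ℕ} (β : ℝ) (x : Plane n) (c : ℝ) (p : Plane n) : ℝ :=
  (‖x - p‖ ^ 2 - β ^ 2) / (2 * β) + c

/-- `(z, w)` is a two-reflector of type A: `z` and `w` are continuous on the closures of `Ω` and
`T`, `z(x) = sup_{p ∈ T̄} k_{p,w(p)}(x)` on `Ω̄`, and `w(p) = inf_{x ∈ Ω̄} h_{x,z(x)}(p)` on `T̄`.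
Only the values of `z` on `Ω̄` and of `w` on `T̄` matter. -/
structure IsTwoReflectorA {n : ℕ} (Ω T : Set (Plane n)) (β : ℝ) (z w : Plane n → ℝ) : Prop where
  continuousOn_z : ContinuousOn z (closure Ω)
  continuousOn_w : ContinuousOn w (closure T)
  z_eq_sup : ∀ x ∈ closure Ω, IsLUB ((fun p => paraboloidK β p (w p) x) '' closure T) (z x)
  w_eq_inf : ∀ p ∈ closure T, IsGLB ((fun x => paraboloidH β x (z x) p) '' closure Ω) (w p)

/-- `(z, w)` is a two-reflector of type B: as for type A, with `sup` and `inf` exchanged. -/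
structure IsTwoReflectorB {n : ℕ} (Ω T : Set (Plane n)) (β : ℝ) (z w : Plane n → ℝ) : Prop where
  continuousOn_z : ContinuousOn z (closure Ω)
  continuousOn_w : ContinuousOn w (closure T)
  z_eq_inf : ∀ x ∈ closure Ω, IsGLB ((fun p => paraboloidK β p (w p) x) '' closure T) (z x)
  w_eq_sup : ∀ p ∈ closure T, IsLUB ((fun x => paraboloidH β x (z x) p) '' closure Ω) (w p)

/-- The affine function `Q(x, p) = ⟨x, p⟩ + β w(p) - |p|² / 2` of `x`. -/
def planeQ {n : ℕ} (β : ℝ) (w : Plane n → ℝ) (x p : Plane n) : ℝ :=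
  inner ℝ x p + β * w p - ‖p‖ ^ 2 / 2

/-- The potential of a type A two-reflector on the whole plane,
`V*(x) = sup_{p ∈ T̄} Q(x, p)` (the supremum is over a compact set, of a function
continuous in `p`). On `Ω̄` it equals `|x|² / 2 + β z(x) - β² / 2`. -/
def potentialA {n : ℕ} (T : Set (Plane n)) (β : ℝ) (w : Plane n → ℝ) (x : Plane n) : ℝ :=
  sSup ((fun p => planeQ β w x p) '' closure T)

/-- The (concave) potential of a type B two-reflector on the whole plane,
`V*(x) = inf_{p ∈ T̄} Q(x, p)`. On `Ω̄` it equals `|x|² / 2 + β z(x) - β² / 2`. -/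
def potentialB {n : ℕ} (T : Set (Plane n)) (β : ℝ) (w : Plane n → ℝ) (x : Plane n) : ℝ :=
  sInf ((fun p => planeQ β w x p) '' closure T)

/-- The normal map of a convex function `u` on the plane: the set of all `p` such that the
hyperplane `Z - u(x₀) = ⟨p, x - x₀⟩` supports the graph of `u` from below at `(x₀, u(x₀))`. -/
def normalMap {n : ℕ} (u : Plane n → ℝ) (x₀ : Plane n) : Set (Plane n) :=
  {p | ∀ x : Plane n, u x₀ + inner ℝ p (x - x₀) ≤ u x}

/-- The (possibly multivalued) ray tracing map of a type A two-reflector. -/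
def rayTracingA {n : ℕ} (T : Set (Plane n)) (β : ℝ) (w : Plane n → ℝ) (x : Plane n) :
    Set (Plane n) :=
  normalMap (potentialA T β w) x

/-- The (possibly multivalued) ray tracing map of a type B two-reflector: the set of all `p` such
that the hyperplane of slope `p` through `(x, V*(x))` supports the graph of the concave function
`V*` from above, that is, `-p` belongs to the normal map of the convex function `-V*`. -/
def rayTracingB {n : ℕ} (T : Set (Plane n)) (β : ℝ) (w : Plane n → ℝ) (x : Plane n) :
    Set (Plane n) :=
  {p | -p ∈ normalMap (fun y => -potentialB T β w y) x}

/-- The inverse image of `τ` under a multivalued map `P`: the union over `p ∈ τ` of the sets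
`{x | p ∈ P(x)}`. -/
def multiPreimage {n : ℕ} (P : Plane n → Set (Plane n)) (τ : Set (Plane n)) : Set (Plane n) :=
  {x | ∃ p ∈ τ, p ∈ P x}

/-- `λ(τ) = ∫_{P⁻¹(τ)} I(x) dx`, where `I` is extended by zero outside `Ω`. -/
def transportedIntensity {n : ℕ} (Ω : Set (Plane n)) (I : Plane n → ℝ)
    (P : Plane n → Set (Plane n)) (τ : Set (Plane n)) : ℝ :=
  ∫ x in multiPreimage P τ, Ω.indicator I x

/-- The multivalued map `P` maps `Ω̄` onto `T̄` and transports the intensity `I` on `Ω` to the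
intensity `L` on `T`. -/
structure IsEnergyPreserving {n : ℕ} (Ω T : Set (Plane n)) (I L : Plane n → ℝ)
    (P : Plane n → Set (Plane n)) : Prop where
  onto : ∀ p ∈ closure T, ∃ x ∈ closure Ω, p ∈ P x
  energy : ∀ τ : Set (Plane n), τ ⊆ T → MeasurableSet τ →
    transportedIntensity Ω I P τ = ∫ p in τ, L p

/-- Weak solutions of type A of the two-reflector problem. -/
structure IsWeakSolutionA {n : ℕ} (Ω T : Set (Plane n)) (β : ℝ) (I L : Plane n → ℝ)
    (z w : Plane n → ℝ) : Prop where
  isTwoReflector : IsTwoReflectorA Ω T β z w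
  isEnergyPreserving : IsEnergyPreserving Ω T I L (rayTracingA T β w)

/-- Weak solutions of type B of the two-reflector problem. -/
structure IsWeakSolutionB {n : ℕ} (Ω T : Set (Plane n)) (β : ℝ) (I L : Plane n → ℝ)
    (z w : Plane n → ℝ) : Prop where
  isTwoReflector : IsTwoReflectorB Ω T β z w
  isEnergyPreserving : IsEnergyPreserving Ω T I L (rayTracingB T β w)

end TwoReflector

end

/-!
Multiplying `z` by `β` and adding `‖x‖² / 2 - β² / 2` turns a type A reflector into the convex
potential `U = sup_{p ∈ T̄} (⟨x, p⟩ - ψ p)` with `ψ p = ‖p‖² / 2 - β w p`, and the ray tracing map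
into its subgradient map. For type B the same holds for `-V*` after the reflection `p ↦ -p` of the
slopes, so that both types follow from one uniqueness theorem for convex potentials,
`exists_legendreOn_eq_add_const`.

That theorem rests on the duality argument of optimal transport. Let `U` and `V` be potentials
given by `ψ` and `φ`. They are Lipschitz, hence differentiable almost everywhere, and there the
gradient is the only subgradient. The energy condition, together with the equality of the total
energies, says that `∇U` and `∇V` take values in `T` almost everywhere and push the measure `I dx`
on `Ω` forward to the same measure. By the Young inequality the defects
`U x + ψ (∇V x) - ⟨x, ∇V x⟩` and `V x + φ (∇U x) - ⟨x, ∇U x⟩` are nonnegative, while their sum is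
`ψ (∇V x) - ψ (∇U x) + φ (∇U x) - φ (∇V x)`, which has integral zero. So both vanish
`I dx`-almost everywhere, and `∇V x` is a subgradient of `U` as well as of `V` at `x`
(`ae_gradient_mem_normalMap`).

As `I > 0` on `Ω`, the points with a common subgradient are dense in `Ω`; since subgradients
stay in a compact set, every point of `Ω` has one
(`exists_common_subgradient_of_mem_closure`). If `q` is a common subgradient at each point, then
`|(U - V) b - (U - V) a| ≤ ⟨q b - q a, b - a⟩`. Along a subdivision of a segment into `N` equal
parts these bounds telescope to `O(1 / N)`, so `U - V` is locally constant
(`sub_eq_sub_of_common_subgradient_on_segment`), hence constant on the connected set `Ω`.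
Continuity carries `z' = z + ρ` to the closure, and the formula for `w` in terms of `z` gives
`w' = w + ρ`.
-/

open Set Filter Topology

namespace TwoReflector

variable {n : ℕ}

/-! ### Convex potentials over a compact set of slopes -/

/-- The Legendre transform of `ψ` over a set `K` of slopes, `x ↦ sup_{p ∈ K} (⟨x, p⟩ - ψ p)`.
The supremum is attained when `K` is nonempty and compact and `ψ` is continuous on `K`. -/
noncomputable def legendreOn (K : Set (Plane n)) (ψ : Plane n → ℝ) (x : Plane n) : ℝ :=
  sSup ((fun p => inner ℝ x p - ψ p) '' K)

section Legendre

variable {K : Set (Plane n)} {ψ : Plane n → ℝ}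

lemma continuousOn_inner_sub (hψ : ContinuousOn ψ K) (x : Plane n) :
    ContinuousOn (fun p => inner ℝ x p - ψ p) K :=
  (Continuous.continuousOn (by fun_prop)).sub hψ

lemma le_legendreOn (hK : IsCompact K) (hψ : ContinuousOn ψ K) (x : Plane n) {p : Plane n}
    (hp : p ∈ K) : inner ℝ x p - ψ p ≤ legendreOn K ψ x :=
  le_csSup (hK.bddAbove_image (continuousOn_inner_sub hψ x)) (mem_image_of_mem _ hp)

lemma exists_legendreOn_eq (hK : IsCompact K) (hne : K.Nonempty) (hψ : ContinuousOn ψ K)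
    (x : Plane n) : ∃ p ∈ K, legendreOn K ψ x = inner ℝ x p - ψ p :=
  hK.exists_sSup_image_eq hne (continuousOn_inner_sub hψ x)

lemma exists_lipschitzWith_legendreOn (hK : IsCompact K) (hne : K.Nonempty)
    (hψ : ContinuousOn ψ K) : ∃ C, LipschitzWith C (legendreOn K ψ) := by
  obtain ⟨C, hC0, hC⟩ := hK.isBounded.exists_pos_norm_le
  refine ⟨C.toNNReal, LipschitzWith.of_le_add_mul' C fun x y => ?_⟩
  obtain ⟨p, hp, hpx⟩ := exists_legendreOn_eq hK hne hψ x
  have h1 := le_legendreOn hK hψ y hp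
  have h2 : inner ℝ (x - y) p ≤ ‖x - y‖ * ‖p‖ := real_inner_le_norm _ _
  have h3 : ‖x - y‖ * ‖p‖ ≤ ‖x - y‖ * C := by gcongr; exact hC p hp
  rw [inner_sub_left] at h2
  rw [dist_eq_norm]
  linarith

/-- Equality in the Young inequality makes `p` a subgradient. -/
lemma mem_normalMap_of_legendreOn_le (hK : IsCompact K) (hψ : ContinuousOn ψ K)
    {x p : Plane n} (hp : p ∈ K) (h : legendreOn K ψ x ≤ inner ℝ x p - ψ p) :
    p ∈ normalMap (legendreOn K ψ) x := by
  intro y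
  have h1 := le_legendreOn hK hψ y hp
  rw [inner_sub_right, real_inner_comm y p, real_inner_comm x p]
  linarith

/-- At a point of differentiability the gradient is the only subgradient. -/
lemma eq_gradient_of_mem_normalMap {U : Plane n → ℝ} {x p : Plane n}
    (hU : DifferentiableAt ℝ U x) (hp : p ∈ normalMap U x) : p = gradient U x := by
  have hmin : IsLocalMin (fun y => U y - inner ℝ p y) x := by
    refine Eventually.of_forall fun y => ?_
    have := hp y
    rw [inner_sub_right] at this
    simp only
    linarith
  have hd : HasFDerivAt (fun y => U y - inner ℝ p y)
      (fderiv ℝ U x - innerSL ℝ p) x :=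
    hU.hasFDerivAt.sub (innerSL ℝ p).hasFDerivAt
  have h0 := hmin.hasFDerivAt_eq_zero hd
  refine ext_inner_right ℝ fun v => ?_
  have h1 := DFunLike.congr_fun h0 v
  simp only [sub_apply, innerSL_apply_apply,
    zero_apply] at h1
  rw [inner_gradient_left]
  linarith

lemma gradient_legendreOn_spec (hK : IsCompact K) (hne : K.Nonempty) (hψ : ContinuousOn ψ K)
    {x : Plane n} (hx : DifferentiableAt ℝ (legendreOn K ψ) x) :
    gradient (legendreOn K ψ) x ∈ K ∧
      legendreOn K ψ x
        = inner ℝ x (gradient (legendreOn K ψ) x) - ψ (gradient (legendreOn K ψ) x) ∧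
      normalMap (legendreOn K ψ) x = {gradient (legendreOn K ψ) x} := by
  obtain ⟨p, hp, hpx⟩ := exists_legendreOn_eq hK hne hψ x
  have hmem := mem_normalMap_of_legendreOn_le hK hψ hp hpx.le
  obtain rfl := eq_gradient_of_mem_normalMap hx hmem
  exact ⟨hp, hpx, Subset.antisymm (fun q hq => eq_gradient_of_mem_normalMap hx hq)
    (singleton_subset_iff.2 hmem)⟩

lemma ae_differentiableAt_legendreOn (hK : IsCompact K) (hne : K.Nonempty)
    (hψ : ContinuousOn ψ K) : ∀ᵐ x : Plane n, DifferentiableAt ℝ (legendreOn K ψ) x := by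
  obtain ⟨C, hC⟩ := exists_lipschitzWith_legendreOn hK hne hψ
  exact hC.ae_differentiableAt

end Legendre

lemma measurable_gradient (U : Plane n → ℝ) : Measurable (gradient U) :=
  (InnerProductSpace.toDual ℝ (Plane n)).symm.continuous.measurable.comp (measurable_fderiv ℝ U)

/-! ### Potentials with a common subgradient at every point -/

/-- The set of points at which `U` and `V` share a subgradient from a compact set is closed. -/
lemma exists_common_subgradient_of_mem_closure {K D : Set (Plane n)} {U V : Plane n → ℝ}
    (hK : IsCompact K) (hU : Continuous U) (hV : Continuous V)
    (hD : ∀ x ∈ D, ∃ p ∈ K, p ∈ normalMap U x ∧ p ∈ normalMap V x)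
    {x : Plane n} (hx : x ∈ closure D) :
    ∃ p ∈ K, p ∈ normalMap U x ∧ p ∈ normalMap V x := by
  obtain ⟨u, hu, hux⟩ := mem_closure_iff_seq_limit.1 hx
  choose p hpK hpU hpV using fun k => hD (u k) (hu k)
  obtain ⟨q, hq, φ, hφ, hlim⟩ := hK.tendsto_subseq hpK
  have hux' := hux.comp hφ.tendsto_atTop
  have key : ∀ W : Plane n → ℝ, Continuous W → (∀ k, p k ∈ normalMap W (u k)) →
      q ∈ normalMap W x := fun W hW hp y =>
    le_of_tendsto' (((hW.tendsto x).comp hux').add (hlim.inner (tendsto_const_nhds.sub hux')))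
      fun k => hp (φ k) y
  exact ⟨q, hq, key U hU hpU, key V hV hpV⟩

/-- A common subgradient at both ends of a segment bounds the increment of the difference of the
two functions by the increment of the subgradient; along a fine subdivision of the segment these
bounds telescope. -/
lemma sub_eq_sub_of_common_subgradient_on_segment {U V : Plane n → ℝ} {x y : Plane n}
    (h : ∀ a ∈ segment ℝ x y, ∃ p, p ∈ normalMap U a ∧ p ∈ normalMap V a) :
    U y - V y = U x - V x := by
  choose! q hqU hqV using h
  have hstep : ∀ a ∈ segment ℝ x y, ∀ b ∈ segment ℝ x y,
      |(U b - V b) - (U a - V a)| ≤ inner ℝ (q b - q a) (b - a) := by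
    intro a ha b hb
    have h1 := hqU a ha b
    have h2 := hqV a ha b
    have h3 := hqU b hb a
    have h4 := hqV b hb a
    rw [← neg_sub b a, inner_neg_right] at h3 h4
    rw [inner_sub_left, abs_le]
    constructor <;> linarith
  have hbound : ∀ N : ℕ, |(U y - V y) - (U x - V x)|
      ≤ inner ℝ (q y - q x) (y - x) * (1 / ((N : ℝ) + 1)) := by
    intro N
    have hN : (0 : ℝ) < (N : ℝ) + 1 := by positivity
    let a : ℕ → Plane n := fun i => x + ((i : ℝ) / (N + 1)) • (y - x)
    have ha : ∀ i ≤ N + 1, a i ∈ segment ℝ x y := by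
      intro i hi
      rw [segment_eq_image']
      refine ⟨(i : ℝ) / (N + 1), ⟨by positivity, ?_⟩, rfl⟩
      rw [div_le_one hN]
      exact_mod_cast hi
    have ha0 : a 0 = x := by simp [a]
    have haN : a (N + 1) = y := by
      simp only [a]
      push_cast
      rw [div_self hN.ne', one_smul]
      abel
    have hdiff : ∀ i, a (i + 1) - a i = (1 / ((N : ℝ) + 1)) • (y - x) := by
      intro i
      simp only [a, add_sub_add_left_eq_sub, ← sub_smul]
      congr 1
      push_cast
      ring
    have hsum : ∀ m ≤ N + 1, |(U (a m) - V (a m)) - (U (a 0) - V (a 0))|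
        ≤ inner ℝ (q (a m) - q (a 0)) (y - x) * (1 / ((N : ℝ) + 1)) := by
      intro m
      induction m with
      | zero => simp
      | succ m ih =>
        intro hm
        have h1 := ih (by omega)
        have h2 := hstep (a m) (ha m (by omega)) (a (m + 1)) (ha _ hm)
        rw [hdiff, inner_smul_right] at h2
        have h3 : inner ℝ (q (a (m + 1)) - q (a 0)) (y - x)
            = inner ℝ (q (a (m + 1)) - q (a m)) (y - x)
              + inner ℝ (q (a m) - q (a 0)) (y - x) := by
          rw [← inner_add_left, sub_add_sub_cancel]
        calc |(U (a (m + 1)) - V (a (m + 1))) - (U (a 0) - V (a 0))|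
            ≤ |(U (a (m + 1)) - V (a (m + 1))) - (U (a m) - V (a m))|
              + |(U (a m) - V (a m)) - (U (a 0) - V (a 0))| := abs_sub_le _ _ _
          _ ≤ _ := by rw [h3]; linarith
    simpa only [ha0, haN] using hsum (N + 1) le_rfl
  have hlim : Tendsto (fun N : ℕ => inner ℝ (q y - q x) (y - x) * (1 / ((N : ℝ) + 1))) atTop
      (𝓝 0) := by
    simpa using tendsto_one_div_add_atTop_nhds_zero_nat.const_mul (inner ℝ (q y - q x) (y - x))
  exact sub_eq_zero.1 (abs_nonpos_iff.1 (ge_of_tendsto' hlim hbound))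

lemma exists_sub_eq_const_of_common_subgradient {Ω : Set (Plane n)} (hΩ : IsOpen Ω)
    (hc : IsPreconnected Ω) {U V : Plane n → ℝ}
    (h : ∀ a ∈ Ω, ∃ p, p ∈ normalMap U a ∧ p ∈ normalMap V a) :
    ∃ c, ∀ x ∈ Ω, U x - V x = c := by
  have hloc : ∀ x ∈ Ω, HasFDerivAt (fun y => U y - V y) (0 : Plane n →L[ℝ] ℝ) x := by
    intro x hx
    obtain ⟨r, hr, hball⟩ := Metric.isOpen_iff.1 hΩ x hx
    refine (hasFDerivAt_const (U x - V x) x).congr_of_eventuallyEq ?_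
    filter_upwards [Metric.ball_mem_nhds x hr] with y hy
    exact sub_eq_sub_of_common_subgradient_on_segment fun a ha =>
      h a (hball ((convex_ball x r).segment_subset (Metric.mem_ball_self hr) hy ha))
  exact hΩ.exists_is_const_of_fderiv_eq_zero hc
    (fun x hx => (hloc x hx).differentiableAt.differentiableWithinAt)
    (fun x hx => (hloc x hx).fderiv)

/-! ### The energy condition and equality of gradients -/

/-- The measure on the plane with density `I` on `Ω` and `0` elsewhere. -/
noncomputable def intensityMeasure (Ω : Set (Plane n)) (I : Plane n → ℝ) : Measure (Plane n) :=
  (volume.restrict Ω).withDensity fun x => ENNReal.ofReal (I x)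

section Energy

variable {Ω K : Set (Plane n)} {I : Plane n → ℝ}

lemma intensityMeasure_apply (hΩ : MeasurableSet Ω) (hI : IntegrableOn I Ω)
    (hI0 : ∀ x ∈ Ω, 0 < I x) {s : Set (Plane n)} (hs : MeasurableSet s) :
    intensityMeasure Ω I s = ENNReal.ofReal (∫ x in s, Ω.indicator I x) := by
  have h0 : 0 ≤ᵐ[volume.restrict Ω] I :=
    (ae_restrict_mem hΩ).mono fun x hx => (hI0 x hx).le
  rw [intensityMeasure, withDensity_apply _ hs, setIntegral_indicator hΩ,
    ← Measure.restrict_restrict hs,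
    ofReal_integral_eq_lintegral_ofReal (Integrable.restrict (s := s) hI) (ae_restrict_of_ae h0)]

lemma intensityMeasure_ae_iff (hΩ : MeasurableSet Ω) (hI : IntegrableOn I Ω)
    (hI0 : ∀ x ∈ Ω, 0 < I x) {P : Plane n → Prop} :
    (∀ᵐ x ∂intensityMeasure Ω I, P x) ↔ ∀ᵐ x, x ∈ Ω → P x := by
  rw [intensityMeasure, ae_withDensity_iff' hI.1.aemeasurable.ennreal_ofReal,
    ae_restrict_iff' hΩ]
  refine eventually_congr (Eventually.of_forall fun x => forall_congr' fun hx => ?_)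
  simp [hI0 x hx]

/-- Outside a null set the multivalued map `x ↦ normalMap U x` is the gradient of `U`, so both
have the same energy. -/
lemma intensityMeasure_gradient_preimage (hK : IsCompact K) (hne : K.Nonempty)
    {ψ : Plane n → ℝ} (hψ : ContinuousOn ψ K) (hΩ : MeasurableSet Ω) (hI : IntegrableOn I Ω)
    (hI0 : ∀ x ∈ Ω, 0 < I x) {τ : Set (Plane n)} (hτ : MeasurableSet τ) :
    intensityMeasure Ω I (gradient (legendreOn K ψ) ⁻¹' τ)
      = ENNReal.ofReal (transportedIntensity Ω I (normalMap (legendreOn K ψ)) τ) := by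
  rw [intensityMeasure_apply hΩ hI hI0 (measurable_gradient _ hτ), transportedIntensity]
  congr 1
  refine setIntegral_congr_set ?_
  filter_upwards [ae_differentiableAt_legendreOn hK hne hψ] with x hx
  refine propext ?_
  change gradient (legendreOn K ψ) x ∈ τ ↔ ∃ p ∈ τ, p ∈ normalMap (legendreOn K ψ) x
  simp [(gradient_legendreOn_spec hK hne hψ hx).2.2]

/-- The gradients have the same law, so the two nonnegative defects in the Young inequalities
`U x + ψ (∇V x) ≥ ⟨x, ∇V x⟩` and `V x + φ (∇U x) ≥ ⟨x, ∇U x⟩` have a sum of integral zero. -/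
lemma ae_gradient_mem_normalMap (hK : IsCompact K) {T : Set (Plane n)}
    (hT : MeasurableSet T) (hne : K.Nonempty) {ψ φ : Plane n → ℝ}
    (hψ : ContinuousOn ψ K) (hφ : ContinuousOn φ K)
    (hΩ : MeasurableSet Ω) (hI : IntegrableOn I Ω) (hI0 : ∀ x ∈ Ω, 0 < I x)
    (henergy : ∀ τ ⊆ T, MeasurableSet τ →
      transportedIntensity Ω I (normalMap (legendreOn K ψ)) τ
        = transportedIntensity Ω I (normalMap (legendreOn K φ)) τ)
    (htotal : transportedIntensity Ω I (normalMap (legendreOn K ψ)) T = ∫ x in Ω, I x) :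
    ∀ᵐ x ∂intensityMeasure Ω I,
      gradient (legendreOn K φ) x ∈ normalMap (legendreOn K ψ) x := by
  set U := legendreOn K ψ with hU
  set V := legendreOn K φ with hV
  set μ := intensityMeasure Ω I with hμ
  have : IsFiniteMeasure μ := isFiniteMeasure_withDensity_ofReal hI.2
  have hgU : Measurable (gradient U) := measurable_gradient U
  have hgV : Measurable (gradient V) := measurable_gradient V
  have hac : ∀ {P : Plane n → Prop}, (∀ᵐ x, P x) → ∀ᵐ x ∂μ, P x := fun h =>
    (intensityMeasure_ae_iff hΩ hI hI0).2 (h.mono fun _ hx _ => hx)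
  have huniv : μ univ = ENNReal.ofReal (∫ x in Ω, I x) := by
    rw [hμ, intensityMeasure_apply hΩ hI hI0 .univ, setIntegral_univ, integral_indicator hΩ]
  have hlaw : ∀ τ ⊆ T, MeasurableSet τ → μ (gradient U ⁻¹' τ) = μ (gradient V ⁻¹' τ) := by
    intro τ hτ hτm
    rw [hμ, hU, hV, intensityMeasure_gradient_preimage hK hne hψ hΩ hI hI0 hτm,
      intensityMeasure_gradient_preimage hK hne hφ hΩ hI hI0 hτm, ← hU, ← hV, henergy τ hτ hτm]
  have hUT_measure : μ (gradient U ⁻¹' T) = μ univ := by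
    rw [huniv, hμ, hU, intensityMeasure_gradient_preimage hK hne hψ hΩ hI hI0 hT, ← hU, htotal]
  have hUT : ∀ᵐ x ∂μ, gradient U x ∈ T :=
    (ae_iff_measure_eq (hgU hT).nullMeasurableSet).2 hUT_measure
  have hVT : ∀ᵐ x ∂μ, gradient V x ∈ T :=
    (ae_iff_measure_eq (hgV hT).nullMeasurableSet).2
      ((hlaw T Subset.rfl hT).symm.trans hUT_measure)
  have hmap : μ.map (gradient U) = μ.map (gradient V) := by
    ext s hs
    rw [Measure.map_apply hgU hs, Measure.map_apply hgV hs]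
    have e1 : μ (gradient U ⁻¹' s) = μ (gradient U ⁻¹' (s ∩ T)) :=
      measure_congr (hUT.mono fun x hx => propext ⟨fun h => ⟨h, hx⟩, fun h => h.1⟩)
    have e2 : μ (gradient V ⁻¹' s) = μ (gradient V ⁻¹' (s ∩ T)) :=
      measure_congr (hVT.mono fun x hx => propext ⟨fun h => ⟨h, hx⟩, fun h => h.1⟩)
    rw [e1, e2, hlaw _ inter_subset_right (hs.inter hT)]
  -- Only the values of `θ` on `K` matter; the indicator makes it bounded and measurable.
  have hθ : ∀ θ : Plane n → ℝ, ContinuousOn θ K → Measurable (K.indicator θ) ∧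
      ∃ C, ∀ p, ‖K.indicator θ p‖ ≤ C := by
    intro θ hθ
    refine ⟨?_, ?_⟩
    · classical
      rw [← piecewise_eq_indicator]
      exact hθ.measurable_piecewise continuousOn_const hK.measurableSet
    · obtain ⟨C, hC⟩ := hK.exists_bound_of_continuousOn hθ
      refine ⟨max C 0, fun p => ?_⟩
      by_cases hp : p ∈ K
      · rw [indicator_of_mem hp]; exact (hC p hp).trans (le_max_left _ _)
      · rw [indicator_of_notMem hp, norm_zero]; exact le_max_right _ _
  have hint : ∀ θ : Plane n → ℝ, ContinuousOn θ K → ∀ {g : Plane n → Plane n}, Measurable g →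
      Integrable (fun x => K.indicator θ (g x)) μ := by
    intro θ hc g hg
    obtain ⟨C, hC⟩ := (hθ θ hc).2
    exact .of_bound ((hθ θ hc).1.comp hg).aestronglyMeasurable C (.of_forall fun x => hC _)
  have heq : ∀ θ : Plane n → ℝ, ContinuousOn θ K →
      ∫ x, K.indicator θ (gradient U x) ∂μ = ∫ x, K.indicator θ (gradient V x) ∂μ := by
    intro θ hc
    rw [← integral_map hgU.aemeasurable (hθ θ hc).1.aestronglyMeasurable, hmap,
      integral_map hgV.aemeasurable (hθ θ hc).1.aestronglyMeasurable]
  let d : Plane n → ℝ := fun x =>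
    (K.indicator ψ (gradient V x) - K.indicator ψ (gradient U x))
      + (K.indicator φ (gradient U x) - K.indicator φ (gradient V x))
  have hd₁ : Integrable
      (fun x => K.indicator ψ (gradient V x) - K.indicator ψ (gradient U x)) μ :=
    (hint ψ hψ hgV).sub (hint ψ hψ hgU)
  have hd₂ : Integrable
      (fun x => K.indicator φ (gradient U x) - K.indicator φ (gradient V x)) μ :=
    (hint φ hφ hgU).sub (hint φ hφ hgV)
  have hd_int : Integrable d μ := hd₁.add hd₂
  have hd_zero : ∫ x, d x ∂μ = 0 := by
    rw [integral_add hd₁ hd₂, integral_sub (hint ψ hψ hgV) (hint ψ hψ hgU),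
      integral_sub (hint φ hφ hgU) (hint φ hφ hgV), heq ψ hψ, heq φ hφ]
    ring
  have hd_eq : ∀ᵐ x ∂μ, gradient V x ∈ K ∧
      0 ≤ U x + ψ (gradient V x) - inner ℝ x (gradient V x) ∧
      U x + ψ (gradient V x) - inner ℝ x (gradient V x) ≤ d x := by
    filter_upwards [hac (ae_differentiableAt_legendreOn hK hne hψ),
      hac (ae_differentiableAt_legendreOn hK hne hφ)] with x hxU hxV
    obtain ⟨hUK, hUx, -⟩ := gradient_legendreOn_spec hK hne hψ hxU
    obtain ⟨hVK, hVx, -⟩ := gradient_legendreOn_spec hK hne hφ hxV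
    rw [← hU] at hUK hUx
    rw [← hV] at hVK hVx
    have h1 := le_legendreOn hK hψ x hVK
    have h2 := le_legendreOn hK hφ x hUK
    rw [← hU] at h1
    rw [← hV] at h2
    simp only [d, indicator_of_mem hUK, indicator_of_mem hVK]
    exact ⟨hVK, by linarith, by linarith⟩
  have hd_nonneg : 0 ≤ᵐ[μ] d := hd_eq.mono fun x hx => hx.2.1.trans hx.2.2
  filter_upwards [(integral_eq_zero_iff_of_nonneg_ae hd_nonneg hd_int).1 hd_zero, hd_eq]
    with x hx0 hx
  have h0 : d x = 0 := hx0
  exact mem_normalMap_of_legendreOn_le hK hψ hx.1 (by rw [← hU]; linarith [hx.2.2])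

/-- Uniqueness up to a constant of the convex potential whose subgradient map has a prescribed
energy. -/
theorem exists_legendreOn_eq_add_const (hK : IsCompact K) {T : Set (Plane n)}
    (hT : MeasurableSet T) (hne : K.Nonempty) {ψ φ : Plane n → ℝ}
    (hψ : ContinuousOn ψ K) (hφ : ContinuousOn φ K)
    (hΩ : IsOpen Ω) (hΩc : IsPreconnected Ω) (hI : IntegrableOn I Ω) (hI0 : ∀ x ∈ Ω, 0 < I x)
    (henergy : ∀ τ ⊆ T, MeasurableSet τ →
      transportedIntensity Ω I (normalMap (legendreOn K ψ)) τ
        = transportedIntensity Ω I (normalMap (legendreOn K φ)) τ)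
    (htotal : transportedIntensity Ω I (normalMap (legendreOn K ψ)) T = ∫ x in Ω, I x) :
    ∃ c, ∀ x ∈ Ω, legendreOn K φ x = legendreOn K ψ x + c := by
  obtain ⟨C, hC⟩ := exists_lipschitzWith_legendreOn hK hne hψ
  obtain ⟨C', hC'⟩ := exists_lipschitzWith_legendreOn hK hne hφ
  have hae := (intensityMeasure_ae_iff hΩ.measurableSet hI hI0).1
    (ae_gradient_mem_normalMap hK hT hne hψ hφ hΩ.measurableSet hI hI0 henergy htotal)
  have hdense := Measure.dense_of_ae (hae.and (ae_differentiableAt_legendreOn hK hne hφ))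
  have hcommon : ∀ x ∈ Ω, ∃ p ∈ K, p ∈ normalMap (legendreOn K φ) x ∧
      p ∈ normalMap (legendreOn K ψ) x := by
    intro x hx
    refine exists_common_subgradient_of_mem_closure hK hC'.continuous hC.continuous ?_
      (hdense.open_subset_closure_inter hΩ hx)
    rintro y ⟨hyΩ, hy, hdiff⟩
    obtain ⟨h1, -, h3⟩ := gradient_legendreOn_spec hK hne hφ hdiff
    exact ⟨_, h1, h3.symm ▸ mem_singleton _, hy hyΩ⟩
  obtain ⟨c, hc⟩ := exists_sub_eq_const_of_common_subgradient hΩ hΩc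
    fun x hx => (hcommon x hx).imp fun p hp => hp.2
  exact ⟨c, fun x hx => by linarith [hc x hx]⟩

end Energy

/-! ### From reflectors to potentials and back -/

section Reflectors

variable {T : Set (Plane n)} {β : ℝ}

lemma paraboloidK_eq_planeQ (hβ : 0 < β) (w : Plane n → ℝ) (x p : Plane n) :
    paraboloidK β p (w p) x = (planeQ β w x p + (β ^ 2 / 2 - ‖x‖ ^ 2 / 2)) / β := by
  rw [paraboloidK, planeQ, norm_sub_sq_real]
  field_simp
  ring

lemma planeQ_eq_paraboloidK (hβ : 0 < β) (w : Plane n → ℝ) (x p : Plane n) :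
    planeQ β w x p = β * paraboloidK β p (w p) x - (β ^ 2 / 2 - ‖x‖ ^ 2 / 2) := by
  rw [paraboloidK_eq_planeQ hβ]
  field_simp
  ring

lemma paraboloidH_add (x p : Plane n) (c ρ : ℝ) :
    paraboloidH β x (c + ρ) p = paraboloidH β x c p + ρ := by
  simp only [paraboloidH]
  ring

lemma potentialA_eq_legendreOn (w : Plane n → ℝ) :
    potentialA T β w = legendreOn (closure T) fun p => ‖p‖ ^ 2 / 2 - β * w p := by
  funext x
  simp only [potentialA, legendreOn, planeQ]
  congr 2
  funext p
  ring

/-- The reflection `p ↦ -p` of the slopes turns the concave type B potential into a convex one. -/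
lemma neg_potentialB_eq_legendreOn (w : Plane n → ℝ) :
    (fun x => -potentialB T β w x)
      = legendreOn (-closure T) fun p => β * w (-p) - ‖p‖ ^ 2 / 2 := by
  funext x
  simp only [potentialB, legendreOn, Real.sInf_def, neg_neg]
  congr 1
  ext r
  simp only [planeQ, Set.mem_neg, mem_image]
  constructor
  · rintro ⟨p, hp, hr⟩
    refine ⟨-p, by simpa using hp, ?_⟩
    rw [neg_neg, inner_neg_right, norm_neg]
    linarith
  · rintro ⟨p, hp, hr⟩
    refine ⟨-p, hp, ?_⟩
    rw [inner_neg_right, norm_neg]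
    linarith

lemma multiPreimage_rayTracingB (w : Plane n → ℝ) (τ : Set (Plane n)) :
    multiPreimage (normalMap fun y => -potentialB T β w y) τ
      = multiPreimage (rayTracingB T β w) (-τ) := by
  ext x
  simp only [multiPreimage, rayTracingB, mem_ofPred_eq, Set.mem_neg]
  exact ⟨fun ⟨p, hp, h⟩ => ⟨-p, by simpa using hp, by simpa using h⟩,
    fun ⟨p, hp, h⟩ => ⟨-p, hp, h⟩⟩

lemma IsTwoReflectorA.potentialA_eq {Ω : Set (Plane n)} {z w : Plane n → ℝ} (hβ : 0 < β)
    (hne : T.Nonempty) (h : IsTwoReflectorA Ω T β z w) {x : Plane n} (hx : x ∈ closure Ω) :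
    potentialA T β w x = β * z x - (β ^ 2 / 2 - ‖x‖ ^ 2 / 2) := by
  refine IsLUB.csSup_eq ?_ (hne.closure.image _)
  have hz := h.z_eq_sup x hx
  refine ⟨?_, fun b hb => ?_⟩
  · rintro _ ⟨p, hp, rfl⟩
    have := mul_le_mul_of_nonneg_left (hz.1 (mem_image_of_mem _ hp)) hβ.le
    simp only [planeQ_eq_paraboloidK hβ]
    linarith
  · have : z x ≤ (b + (β ^ 2 / 2 - ‖x‖ ^ 2 / 2)) / β := by
      refine hz.2 ?_
      rintro _ ⟨p, hp, rfl⟩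
      simp only [paraboloidK_eq_planeQ hβ]
      gcongr
      exact hb (mem_image_of_mem _ hp)
    rw [le_div_iff₀ hβ] at this
    linarith

lemma IsTwoReflectorB.potentialB_eq {Ω : Set (Plane n)} {z w : Plane n → ℝ} (hβ : 0 < β)
    (hne : T.Nonempty) (h : IsTwoReflectorB Ω T β z w) {x : Plane n} (hx : x ∈ closure Ω) :
    potentialB T β w x = β * z x - (β ^ 2 / 2 - ‖x‖ ^ 2 / 2) := by
  refine IsGLB.csInf_eq ?_ (hne.closure.image _)
  have hz := h.z_eq_inf x hx
  refine ⟨?_, fun b hb => ?_⟩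
  · rintro _ ⟨p, hp, rfl⟩
    have := mul_le_mul_of_nonneg_left (hz.1 (mem_image_of_mem _ hp)) hβ.le
    simp only [planeQ_eq_paraboloidK hβ]
    linarith
  · have : (b + (β ^ 2 / 2 - ‖x‖ ^ 2 / 2)) / β ≤ z x := by
      refine hz.2 ?_
      rintro _ ⟨p, hp, rfl⟩
      simp only [paraboloidK_eq_planeQ hβ]
      gcongr
      exact hb (mem_image_of_mem _ hp)
    rw [div_le_iff₀ hβ] at this
    linarith

lemma image_paraboloidH_add {Ω : Set (Plane n)} {z z' : Plane n → ℝ} {ρ : ℝ}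
    (hz : ∀ x ∈ closure Ω, z' x = z x + ρ) (p : Plane n) :
    (fun x => paraboloidH β x (z' x) p) '' closure Ω
      = OrderIso.addRight ρ '' ((fun x => paraboloidH β x (z x) p) '' closure Ω) := by
  rw [image_image]
  refine image_congr fun x hx => ?_
  rw [hz x hx, paraboloidH_add]
  rfl

/-- Since `w` is determined by `z`, a translation of `z` on `Ω` forces the same translation of the
whole type A reflector system. -/
lemma IsTwoReflectorA.eq_add_of_eqOn {Ω : Set (Plane n)} {z w z' w' : Plane n → ℝ} {ρ : ℝ}
    (h : IsTwoReflectorA Ω T β z w) (h' : IsTwoReflectorA Ω T β z' w')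
    (hz : ∀ x ∈ Ω, z' x = z x + ρ) :
    (∀ x ∈ closure Ω, z' x = z x + ρ) ∧ (∀ p ∈ closure T, w' p = w p + ρ) := by
  have hz' : ∀ x ∈ closure Ω, z' x = z x + ρ :=
    EqOn.of_subset_closure (f := z') (g := fun x => z x + ρ) hz h'.continuousOn_z
      (h.continuousOn_z.add continuousOn_const) subset_closure Subset.rfl
  refine ⟨hz', fun p hp => ?_⟩
  have h1 := h'.w_eq_inf p hp
  rw [image_paraboloidH_add hz' p] at h1
  exact h1.unique ((OrderIso.addRight ρ).isGLB_image'.2 (h.w_eq_inf p hp))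

lemma IsTwoReflectorB.eq_add_of_eqOn {Ω : Set (Plane n)} {z w z' w' : Plane n → ℝ} {ρ : ℝ}
    (h : IsTwoReflectorB Ω T β z w) (h' : IsTwoReflectorB Ω T β z' w')
    (hz : ∀ x ∈ Ω, z' x = z x + ρ) :
    (∀ x ∈ closure Ω, z' x = z x + ρ) ∧ (∀ p ∈ closure T, w' p = w p + ρ) := by
  have hz' : ∀ x ∈ closure Ω, z' x = z x + ρ :=
    EqOn.of_subset_closure (f := z') (g := fun x => z x + ρ) hz h'.continuousOn_z
      (h.continuousOn_z.add continuousOn_const) subset_closure Subset.rfl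
  refine ⟨hz', fun p hp => ?_⟩
  have h1 := h'.w_eq_sup p hp
  rw [image_paraboloidH_add hz' p] at h1
  exact h1.unique ((OrderIso.addRight ρ).isLUB_image'.2 (h.w_eq_sup p hp))

end Reflectors

section Uniqueness

variable {Ω T : Set (Plane n)} {β : ℝ} {I L z w z' w' : Plane n → ℝ}

theorem IsWeakSolutionA.exists_eq_add_const (hΩ : IsBoundedDomain Ω) (hT : IsBoundedDomain T)
    (hβ : 0 < β) (hI : IntegrableOn I Ω) (hI0 : ∀ x ∈ Ω, 0 < I x)
    (hEC : ∫ p in T, L p = ∫ x in Ω, I x)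
    (h : IsWeakSolutionA Ω T β I L z w) (h' : IsWeakSolutionA Ω T β I L z' w') :
    ∃ ρ : ℝ, (∀ x ∈ closure Ω, z' x = z x + ρ) ∧ (∀ p ∈ closure T, w' p = w p + ρ) := by
  have hne : T.Nonempty := hT.isConnected.nonempty
  have hψ : ∀ {v : Plane n → ℝ}, ContinuousOn v (closure T) →
      ContinuousOn (fun p => ‖p‖ ^ 2 / 2 - β * v p) (closure T) := fun hv =>
    (Continuous.continuousOn (by fun_prop)).sub (continuousOn_const.mul hv)
  have hP : ∀ v : Plane n → ℝ, normalMap (legendreOn (closure T) fun p => ‖p‖ ^ 2 / 2 - β * v p)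
      = rayTracingA T β v := fun v => by
    rw [← potentialA_eq_legendreOn]
    rfl
  obtain ⟨c, hc⟩ := exists_legendreOn_eq_add_const (Ω := Ω) (I := I)
    hT.isBounded.isCompact_closure hT.isOpen.measurableSet hne.closure
    (hψ h.isTwoReflector.continuousOn_w) (hψ h'.isTwoReflector.continuousOn_w)
    hΩ.isOpen hΩ.isConnected.isPreconnected hI hI0
    (fun τ hτ hτm => by
      rw [hP, hP, h.isEnergyPreserving.energy τ hτ hτm, h'.isEnergyPreserving.energy τ hτ hτm])
    (by rw [hP, h.isEnergyPreserving.energy T Subset.rfl hT.isOpen.measurableSet, hEC])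
  refine ⟨c / β, h.isTwoReflector.eq_add_of_eqOn h'.isTwoReflector fun x hx => ?_⟩
  have h1 := hc x hx
  rw [← potentialA_eq_legendreOn, ← potentialA_eq_legendreOn,
    h.isTwoReflector.potentialA_eq hβ hne (subset_closure hx),
    h'.isTwoReflector.potentialA_eq hβ hne (subset_closure hx)] at h1
  field_simp
  linarith

theorem IsWeakSolutionB.exists_eq_add_const (hΩ : IsBoundedDomain Ω) (hT : IsBoundedDomain T)
    (hβ : 0 < β) (hI : IntegrableOn I Ω) (hI0 : ∀ x ∈ Ω, 0 < I x)
    (hEC : ∫ p in T, L p = ∫ x in Ω, I x)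
    (h : IsWeakSolutionB Ω T β I L z w) (h' : IsWeakSolutionB Ω T β I L z' w') :
    ∃ ρ : ℝ, (∀ x ∈ closure Ω, z' x = z x + ρ) ∧ (∀ p ∈ closure T, w' p = w p + ρ) := by
  have hne : T.Nonempty := hT.isConnected.nonempty
  have hψ : ∀ {v : Plane n → ℝ}, ContinuousOn v (closure T) →
      ContinuousOn (fun p => β * v (-p) - ‖p‖ ^ 2 / 2) (-closure T) := fun hv =>
    (continuousOn_const.mul (hv.comp continuous_neg.continuousOn fun p hp => hp)).sub
      (Continuous.continuousOn (by fun_prop))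
  have hP : ∀ (v : Plane n → ℝ) (τ : Set (Plane n)), transportedIntensity Ω I
      (normalMap (legendreOn (-closure T) fun p => β * v (-p) - ‖p‖ ^ 2 / 2)) τ
      = transportedIntensity Ω I (rayTracingB T β v) (-τ) := fun v τ => by
    rw [← neg_potentialB_eq_legendreOn, transportedIntensity, multiPreimage_rayTracingB,
      transportedIntensity]
  obtain ⟨c, hc⟩ := exists_legendreOn_eq_add_const (Ω := Ω) (I := I) (T := -T)
    hT.isBounded.isCompact_closure.neg hT.isOpen.measurableSet.neg
    hne.closure.neg
    (hψ h.isTwoReflector.continuousOn_w) (hψ h'.isTwoReflector.continuousOn_w)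
    hΩ.isOpen hΩ.isConnected.isPreconnected hI hI0
    (fun τ hτ hτm => by
      have hτ' : -τ ⊆ T := Set.neg_subset.2 hτ
      rw [hP, hP, h.isEnergyPreserving.energy _ hτ' hτm.neg,
        h'.isEnergyPreserving.energy _ hτ' hτm.neg])
    (by rw [hP, neg_neg, h.isEnergyPreserving.energy T Subset.rfl hT.isOpen.measurableSet, hEC])
  -- The convex potential is `-V*`, so its additive constant enters with the opposite sign.
  refine ⟨-c / β, h.isTwoReflector.eq_add_of_eqOn h'.isTwoReflector fun x hx => ?_⟩
  have h1 := hc x hx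
  simp only [← neg_potentialB_eq_legendreOn] at h1
  rw [h.isTwoReflector.potentialB_eq hβ hne (subset_closure hx),
    h'.isTwoReflector.potentialB_eq hβ hne (subset_closure hx)] at h1
  field_simp
  linarith

end Uniqueness

end TwoReflector

theorem mainTheorem4 {n : ℕ} (hn : 2 ≤ n)
    (Ω T : Set (TwoReflector.Plane n))
    (hΩ : TwoReflector.IsBoundedDomain Ω) (hT : TwoReflector.IsBoundedDomain T)
    (β : ℝ) (hβ : 0 < β)
    (I L : TwoReflector.Plane n → ℝ)
    (hI_int : IntegrableOn I Ω) (hI_pos : ∀ x ∈ Ω, 0 < I x)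
    (hL_int : IntegrableOn L T) (hL_nonneg : ∀ p ∈ T, 0 ≤ L p)
    (hEC : ∫ p in T, L p = ∫ x in Ω, I x) :
    (∀ z w z' w' : TwoReflector.Plane n → ℝ,
      TwoReflector.IsWeakSolutionA Ω T β I L z w →
      TwoReflector.IsWeakSolutionA Ω T β I L z' w' →
      ∃ ρ : ℝ, (∀ x ∈ closure Ω, z' x = z x + ρ) ∧ (∀ p ∈ closure T, w' p = w p + ρ)) ∧
    (∀ z w z' w' : TwoReflector.Plane n → ℝ,
      TwoReflector.IsWeakSolutionB Ω T β I L z w →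
      TwoReflector.IsWeakSolutionB Ω T β I L z' w' →
      ∃ ρ : ℝ, (∀ x ∈ closure Ω, z' x = z x + ρ) ∧ (∀ p ∈ closure T, w' p = w p + ρ)) :=
  ⟨fun _ _ _ _ h h' => h.exists_eq_add_const hΩ hT hβ hI_int hI_pos hEC h',
    fun _ _ _ _ h h' => h.exists_eq_add_const hΩ hT hβ hI_int hI_pos hEC h'⟩
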